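/- There is a universal constant $\mathfrak c>1$ such that the following holds. Let $d\ge 1$, $T\ge 2$, let $\mathbb K\in\{\mathbb R,\mathbb C\}$, let $\mathbf M$ be a deterministic real $d\times T$ matrix and observe $\mathbf X=\mathbf M+\varepsilon$. Assume that the rows of the real random $d\times T$ matrix $\varepsilon$ are independent and identically distributed and square integrable with (uncentred) second moment matrix $\Sigma_\varepsilon=\mathbb E[\varepsilon_{1,\cdot}^{*}\varepsilon_{1,\cdot}]$, and that $\varepsilon_{1,\cdot}\Sigma_\varepsilon^{-1/2}$ is isotropic (its second moment matrix is $\mathbf I_T$) with $$\mathfrak K_\varepsilon:=\sup_{\|x\|=1}\ \sup_{p\in[1,\infty)}p^{-1/2}\,\mathbb E\big(|\langle\varepsilon_{1,\cdot}\Sigma_\varepsilon^{-1/2},x\rangle|^p\big)^{1/p}<\infty .$$ Put $\widetilde{\mathfrak K}_\varepsilon:=\max(\mathfrak K_\varepsilon^2,\mathfrak K_\varepsilon^4)$. Let $\mathcal T\subset\{1,\dots,T\}$ and $\mathcal K\subset\{1,\dots,\min(d,T)\}$ be nonempty. For every $\tau\in\mathcal T$ let $\mathbf\Lambda_\tau\in\mathcal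 M_{\tau,T}(\mathbb K)$ be a known matrix such that $\mathbf\Lambda_\tau\mathbf\Lambda_\tau^*=c_\tau\mathbf I_\tau$ for some $c_\tau>0$, let $\mathbf\Lambda_\tau^+=\mathbf\Lambda_\tau^*(\mathbf\Lambda_\tau\mathbf\Lambda_\tau^*)^{-1}$, and for every $(\tau,k)\in\mathcal T\times\mathcal K$ let $\mathcal S_{\tau,k}\subset\mathcal M_{d,\tau}(\mathbb K)$ be a set of matrices of rank at most $k$. Let $$\widehat{\mathbf M}_{\mathcal S_{\tau,k}}=\widehat{\widetilde{\mathbf M}}_{\tau,k}\mathbf\Lambda_\tau,\qquad \widehat{\widetilde{\mathbf M}}_{\tau,k}\in\arg\min_{\mathbf A\in\mathcal S_{\tau,k}}\|\mathbf A-\mathbf X\mathbf\Lambda_\tau^+\|_F^2$$ (minimizers are assumed to exist). Fix $\lambda\in(0,1)$ and $s\ge 0$, put $$\mathrm{pen}_u(\tau,k)=\frac{2\mathfrak c k}{\lambda}(d+\tau+u)\,\widetilde{\mathfrak K}_\varepsilon\|\Sigma_\varepsilon\|_{\rm op}\qquad(u\ge 0),$$ and let $$(\widehat\tau_s,\widehat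 k_s)\in\arg\min_{(\tau,k)\in\mathcal T\times\mathcal K}\Big\{\|\widehat{\mathbf M}_{\mathcal S_{\tau,k}}-\mathbf X\|_F^2+\mathrm{pen}_{s+\tau+k}(\tau,k)\Big\}.$$ Then, with probability at least $1-2e^{-s}$, for all $(\tau,k)\in\mathcal T\times\mathcal K$ and all $\mathbf A\in\mathcal S_{\tau,k}$, $$\frac1{dT}\big\|\widehat{\mathbf M}_{\mathcal S_{\widehat\tau_s,\widehat k_s}}-\mathbf M\big\|_F^2\le\Big(\frac{1+\lambda}{1-\lambda}\Big)^2\frac1{dT}\|\mathbf A\mathbf\Lambda_\tau-\mathbf M\|_F^2+\frac{16\,\mathfrak c\,\widetilde{\mathfrak K}_\varepsilon\|\Sigma_\varepsilon\|_{\rm op}}{\lambda(1-\lambda)^2}\cdot\frac{k(d+\tau+s)}{dT}.$$ Here $\|\cdot\|_F$ is the Frobenius norm and $\|\cdot\|_{\rm op}$ the operator norm for the Euclidean norm. -/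

import Mathlib

open MeasureTheory ProbabilityTheory
open scoped ENNReal Matrix

noncomputable section

namespace TimeSeriesFactorization

/-- The Frobenius norm of a matrix. -/
def frobNorm {𝕜 : Type*} [RCLike 𝕜] {m n : ℕ} (A : Matrix (Fin m) (Fin n) 𝕜) : ℝ :=
  letI := @Matrix.frobeniusNormedAddCommGroup (Fin m) (Fin n) 𝕜 _ _ _
  ‖A‖

/-- The operator norm of a square matrix with respect to the Euclidean norm. -/
def opNorm {n : ℕ} (A : Matrix (Fin n) (Fin n) ℝ) : ℝ :=
  ‖Matrix.toEuclideanCLM (n := Fin n) (𝕜 := ℝ) A‖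

/-- A real matrix, viewed as a matrix over `𝕜`. -/
def ofRealMatrix (𝕜 : Type*) [RCLike 𝕜] {m n : ℕ} (A : Matrix (Fin m) (Fin n) ℝ) :
    Matrix (Fin m) (Fin n) 𝕜 :=
  A.map (fun x : ℝ => (x : 𝕜))

/-- The pseudo-inverse `Λ* (Λ Λ*)⁻¹` of a matrix `Λ` of full row rank. -/
def pseudoInv {𝕜 : Type*} [RCLike 𝕜] {m n : ℕ} (Λ : Matrix (Fin m) (Fin n) 𝕜) :
    Matrix (Fin n) (Fin m) 𝕜 :=
  Λᴴ * (Λ * Λᴴ)⁻¹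

/-- The second moment matrix `E[ξᵀ ξ]` of a real random row vector `ξ`. -/
def secondMoment {Ω : Type*} [MeasurableSpace Ω] (μ : Measure Ω) {n : ℕ}
    (ξ : Ω → Fin n → ℝ) : Matrix (Fin n) (Fin n) ℝ :=
  Matrix.of fun t t' => ∫ ω, ξ ω t * ξ ω t' ∂μ

open scoped MatrixOrder Matrix.Norms.L2Operator in
/-- The inverse square root `Σ^{-1/2}` of a positive definite matrix `Σ`. -/
def invSqrt {n : ℕ} (S : Matrix (Fin n) (Fin n) ℝ) : Matrix (Fin n) (Fin n) ℝ :=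
  (CFC.sqrt S)⁻¹

/-- The normalized row vector `ξ Σ^{-1/2}`, where `Σ` is the second moment matrix of `ξ`. -/
def whiten {Ω : Type*} [MeasurableSpace Ω] (μ : Measure Ω) {n : ℕ}
    (ξ : Ω → Fin n → ℝ) (ω : Ω) : Fin n → ℝ :=
  ξ ω ᵥ* invSqrt (secondMoment μ ξ)

/-- The sub-Gaussian norm `sup_{‖x‖ = 1} sup_{p ≥ 1} p^{-1/2} E(|⟨η, x⟩|^p)^{1/p}` of a real
random vector `η`, with values in `[0, ∞]`. -/
def subGaussianNorm {Ω : Type*} [MeasurableSpace Ω] (μ : Measure Ω) {n : ℕ}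
    (η : Ω → Fin n → ℝ) : ℝ≥0∞ :=
  ⨆ (x : EuclideanSpace ℝ (Fin n)) (_ : ‖x‖ = 1) (p : ℝ) (_ : 1 ≤ p),
    ENNReal.ofReal (p ^ (-(1 / 2) : ℝ)) *
      eLpNorm (fun ω => ∑ t, η ω t * x t) (ENNReal.ofReal p) μ

section Noise

variable {Ω : Type*} [MeasurableSpace Ω] (μ : Measure Ω) {d T : ℕ} [NeZero d]
  (ε : Ω → Matrix (Fin d) (Fin T) ℝ)

/-- The second moment matrix of the rows of the noise. -/
def noiseSigma : Matrix (Fin T) (Fin T) ℝ :=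
  secondMoment μ (fun ω => ε ω 0)

/-- The sub-Gaussian norm of the normalized first row `ε_{1,·} Σ_ε^{-1/2}`. -/
def noiseNorm : ℝ≥0∞ :=
  subGaussianNorm μ (whiten μ (fun ω => ε ω 0))

/-- `K̃_ε = max (K_ε², K_ε⁴)`. -/
def noiseKTilde : ℝ :=
  max ((noiseNorm μ ε).toReal ^ 2) ((noiseNorm μ ε).toReal ^ 4)

/-- The rows of the noise are independent and identically distributed, square integrable, and
the normalized first row is isotropic with finite sub-Gaussian norm. (Isotropy forces the second
moment matrix to be invertible. The rows are not assumed to be centred.) -/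
structure SubGaussianNoise : Prop where
  measurable_row : ∀ i, Measurable (fun ω => ε ω i)
  indep : iIndepFun (fun (i : Fin d) (ω : Ω) => ε ω i) μ
  ident : ∀ i j, IdentDistrib (fun ω => ε ω i) (fun ω => ε ω j) μ μ
  sq_integrable : ∀ t, MemLp (fun ω => ε ω 0 t) 2 μ
  isotropic : secondMoment μ (whiten μ (fun ω => ε ω 0)) = 1
  norm_lt_top : noiseNorm μ ε < ⊤

end Noise

section Estimation

variable {𝕜 : Type*} [RCLike 𝕜] {d T : ℕ}

/-- `A` is an empirical risk minimizer over `S` in the simplified model: it minimizes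
`‖B - X Λ⁺‖_F²` over `B ∈ S`. -/
def IsERM {τ : ℕ} (Λ : Matrix (Fin τ) (Fin T) 𝕜) (S : Set (Matrix (Fin d) (Fin τ) 𝕜))
    (X : Matrix (Fin d) (Fin T) ℝ) (A : Matrix (Fin d) (Fin τ) 𝕜) : Prop :=
  A ∈ S ∧ IsMinOn (fun B => frobNorm (B - ofRealMatrix 𝕜 X * pseudoInv Λ) ^ 2) S A

/-- The penalty `pen_s(τ, k) = (2 𝔠 k / lam) (d + τ + s) v`, where `v` stands for
`K̃_ε ‖Σ_ε‖_op`. -/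
def penalty (𝔠 lam v : ℝ) (d : ℕ) (s : ℝ) (τ k : ℕ) : ℝ :=
  2 * 𝔠 * k / lam * (d + τ + s) * v

/-- The pair `m = (τ̂, k̂)` minimizes `‖M̂_{τ,k} - X‖_F² + pen_{s+τ+k}(τ, k)` over
`(τ, k) ∈ 𝒯 × 𝒦`, where `M̂_{τ,k} = M̃_{τ,k} Λ_τ`. -/
def IsPenalizedSelection (𝔠 lam v s : ℝ) (𝒯 𝒦 : Finset ℕ)
    (Λ : (τ : ℕ) → Matrix (Fin τ) (Fin T) 𝕜) (X : Matrix (Fin d) (Fin T) ℝ)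
    (Mtilde : (τ k : ℕ) → Matrix (Fin d) (Fin τ) 𝕜) (m : ℕ × ℕ) : Prop :=
  m ∈ 𝒯 ×ˢ 𝒦 ∧
    IsMinOn
      (fun q : ℕ × ℕ => frobNorm (Mtilde q.1 q.2 * Λ q.1 - ofRealMatrix 𝕜 X) ^ 2 +
        penalty 𝔠 lam v d (s + q.1 + q.2) q.1 q.2)
      (↑(𝒯 ×ˢ 𝒦) : Set (ℕ × ℕ)) m

end Estimation

end TimeSeriesFactorization

end

/-! Comparing the selected estimator `B` with a competitor `A` through the penalized criterion
leaves the noise term `2⟨ε, B - A⟩`. It suffices to bound `⟨ε, B - A⟩²` by `N ‖B - A‖²` with `N` of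
order `k(d + τ + s) + k'(d + τ' + s)`: then AM-GM moves part of it into the two risks, and the
penalty at the selected pair cancels the `k'` part.

The crude bound, rank `k + k'` times the squared norm of `ε` on the sum of the two row spaces,
contains the cross term `k'τ`, which the target does not control. `sq_sum_inner_sub_le` avoids it.
Project the columns onto the column space of the matrix of smaller rank `k`. The projected
difference has rank at most `k` and rows in the sum of both row spaces; the rest comes from the
other matrix alone, so its rows lie in a single row space. Only the cross term `kτ' ≤ k'τ'` remains.

The norm of `ε` on a fixed subspace is controlled by a net and exponential moments of squares
(`exists_event_boundedOn`), then by a union bound over pairs `(τ, τ')` with weights `exp (-(τ +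
τ'))`. The event involves neither ranks nor estimators, so data-dependent choices are harmless on
it. -/

namespace TimeSeriesFactorization

/-! ### Bounding the noise term by projection onto a column space. -/

section Deterministic

/-- Cauchy–Schwarz for the Frobenius inner product with a family of vectors in a subspace `U`,
when the family `e` is bounded as an operator on the span `W` of the rows. -/
lemma sq_sum_inner_le_of_mem {ι F : Type*} [Fintype ι] [NormedAddCommGroup F]
    [InnerProductSpace ℝ F] (e c : ι → F) (U : Submodule ℝ F) [FiniteDimensional ℝ U]
    (W : Submodule ℝ (EuclideanSpace ℝ ι)) (L : ℝ)
    (hL : ∀ x ∈ W, ‖∑ t, x t • e t‖ ^ 2 ≤ L * ‖x‖ ^ 2)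
    (hc : ∀ t, c t ∈ U) (hW : ∀ u : F, u ∈ U → WithLp.toLp 2 (fun t => inner ℝ u (c t)) ∈ W) :
    (∑ t, inner ℝ (e t) (c t)) ^ 2 ≤ Module.finrank ℝ U * L * ∑ t, ‖c t‖ ^ 2 := by
  set b := stdOrthonormalBasis ℝ U
  have hexp : ∀ t, c t = ∑ j, inner ℝ (b j : F) (c t) • (b j : F) := by
    intro t
    have := congrArg (Subtype.val) (b.sum_repr' ⟨c t, hc t⟩)
    simpa using this.symm
  have hnorm : ∀ t, ∑ j, inner ℝ (b j : F) (c t) ^ 2 = ‖c t‖ ^ 2 := by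
    intro t
    have := b.sum_sq_norm_inner_right ⟨c t, hc t⟩
    simpa using this
  -- Along each basis vector `b j` of `U`, the coordinates of the family `c` form a vector of `W`,
  -- to which `hL` applies.
  have hsum : ∑ t, inner ℝ (e t) (c t) =
      ∑ j, inner ℝ (∑ t, inner ℝ (b j : F) (c t) • e t) (b j : F) := by
    simp_rw [sum_inner]
    rw [Finset.sum_comm]
    refine Finset.sum_congr rfl fun t _ => ?_
    conv_lhs => rw [hexp t, inner_sum]
    refine Finset.sum_congr rfl fun j _ => ?_
    rw [real_inner_smul_left, real_inner_smul_right]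
  rw [hsum]
  calc _ ≤ (Finset.univ : Finset (Fin (Module.finrank ℝ U))).card *
        ∑ j, inner ℝ (∑ t, inner ℝ (b j : F) (c t) • e t) (b j : F) ^ 2 :=
        sq_sum_le_card_mul_sum_sq
    _ ≤ Module.finrank ℝ U * ∑ j, L * ∑ t, inner ℝ (b j : F) (c t) ^ 2 := by
        rw [Finset.card_univ, Fintype.card_fin]
        gcongr with j
        have h1 := hL _ (hW (b j) (b j).2)
        rw [EuclideanSpace.norm_sq_eq] at h1
        simp only [Real.norm_eq_abs, sq_abs] at h1
        refine le_trans ?_ h1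
        have h2 := abs_real_inner_le_norm (∑ t, inner ℝ (b j : F) (c t) • e t) (b j : F)
        have h3 : ‖(b j : F)‖ = 1 := b.orthonormal.1 j
        rw [h3, mul_one] at h2
        rw [← sq_abs]
        gcongr
    _ = _ := by
        rw [← Finset.mul_sum, Finset.sum_comm, ← mul_assoc]
        simp_rw [hnorm]

/-- With `P` the projection onto `U` and `Q = 1 - P`, `p - p' = P (p - p') - Q p'` because `Q p =
0`. The second piece involves `V'` only, so the larger dimension `κ'` is never paired with `V`. The
factor `2` is `(x - y)² ≤ 2x² + 2y²`. -/
lemma sq_sum_inner_sub_le {ι F : Type*} [Fintype ι] [NormedAddCommGroup F]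
    [InnerProductSpace ℝ F] [FiniteDimensional ℝ F] (e p p' : ι → F) (U U' : Submodule ℝ F)
    (V V' : Submodule ℝ (EuclideanSpace ℝ ι)) (L L' : ℝ) (hL0 : 0 ≤ L) (hL0' : 0 ≤ L')
    (κ κ' : ℝ) (hκ : (Module.finrank ℝ U : ℝ) ≤ κ) (hκ' : (Module.finrank ℝ U' : ℝ) ≤ κ')
    (hL : ∀ x ∈ V ⊔ V', ‖∑ t, x t • e t‖ ^ 2 ≤ L * ‖x‖ ^ 2)
    (hL' : ∀ x ∈ V', ‖∑ t, x t • e t‖ ^ 2 ≤ L' * ‖x‖ ^ 2)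
    (hp : ∀ t, p t ∈ U) (hp' : ∀ t, p' t ∈ U')
    (hV : ∀ u : F, WithLp.toLp 2 (fun t => inner ℝ u (p t)) ∈ V)
    (hV' : ∀ u : F, WithLp.toLp 2 (fun t => inner ℝ u (p' t)) ∈ V') :
    (∑ t, inner ℝ (e t) (p t - p' t)) ^ 2 ≤
      2 * (κ * L + κ' * L') * ∑ t, ‖p t - p' t‖ ^ 2 := by
  set P := U.starProjection
  set Q : F →ₗ[ℝ] F := LinearMap.id - (P : F →ₗ[ℝ] F)
  have hQ : ∀ v, Q v = v - P v := fun v => by simp [Q]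
  have hsymm : ∀ u v : F, inner ℝ u (P v) = inner ℝ (P u) v := fun u v =>
    (U.inner_starProjection_left_eq_right u v).symm
  have hQsymm : ∀ u v : F, inner ℝ u (Q v) = inner ℝ (Q u) v := fun u v => by
    rw [hQ, hQ, inner_sub_right, inner_sub_left, hsymm]
  have hQp : ∀ t, Q (p t) = 0 := fun t => by
    rw [hQ, Submodule.starProjection_eq_self_iff.2 (hp t), sub_self]
  have h1 := sq_sum_inner_le_of_mem e (fun t => P (p t - p' t)) U (V ⊔ V') L hL
    (fun t => U.starProjection_apply_mem _) (fun u _ => by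
      have : WithLp.toLp 2 (fun t => inner ℝ u (P (p t - p' t))) =
          WithLp.toLp 2 (fun t => inner ℝ (P u) (p t)) -
          (WithLp.toLp 2 (fun t => inner ℝ (P u) (p' t)) : EuclideanSpace ℝ ι) := by
        ext t
        simp [hsymm, inner_sub_right]
      rw [this]
      exact Submodule.sub_mem _ (Submodule.mem_sup_left (hV _)) (Submodule.mem_sup_right (hV' _)))
  have h2 := sq_sum_inner_le_of_mem e (fun t => Q (p' t)) (U'.map Q) V' L' hL'
    (fun t => Submodule.mem_map_of_mem (hp' t)) (fun u _ => by
      simp_rw [hQsymm]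
      exact hV' _)
  have hsplit : ∑ t, inner ℝ (e t) (p t - p' t) =
      ∑ t, inner ℝ (e t) (P (p t - p' t)) - ∑ t, inner ℝ (e t) (Q (p' t)) := by
    rw [← Finset.sum_sub_distrib]
    refine Finset.sum_congr rfl fun t _ => ?_
    rw [← inner_sub_right]
    congr 1
    have := hQp t
    rw [hQ] at this
    rw [hQ, map_sub]
    rw [sub_eq_zero] at this
    rw [← this]
    abel
  have hn1 : ∀ t, ‖P (p t - p' t)‖ ≤ ‖p t - p' t‖ := fun t => U.norm_starProjection_apply_le _
  -- Since `Q p = 0`, `Q p'` is also `-Q (p - p')`, so it is bounded by the difference and not just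
  -- by `p'`.
  have hn2 : ∀ t, ‖Q (p' t)‖ ≤ ‖p t - p' t‖ := fun t => by
    have : Q (p' t) = -(Q (p t - p' t)) := by rw [map_sub, hQp]; simp
    rw [this, norm_neg, hQ]
    have h3 := U.norm_sq_eq_add_norm_sq_starProjection (p t - p' t)
    rw [Submodule.starProjection_orthogonal_val] at h3
    refine le_of_sq_le_sq ?_ (norm_nonneg _)
    nlinarith [sq_nonneg ‖U.starProjection (p t - p' t)‖]
  have hk2 : (Module.finrank ℝ (U'.map Q) : ℝ) ≤ κ' :=
    le_trans (by exact_mod_cast Submodule.finrank_map_le Q U') hκ'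
  have hκ0 : 0 ≤ κ := le_trans (Nat.cast_nonneg _) hκ
  have hκ0' : 0 ≤ κ' := le_trans (Nat.cast_nonneg _) hκ'
  have h1' : (∑ t, inner ℝ (e t) (P (p t - p' t))) ^ 2 ≤ κ * L * ∑ t, ‖p t - p' t‖ ^ 2 := by
    refine h1.trans ?_
    gcongr with t
    exact hn1 t
  have h2' : (∑ t, inner ℝ (e t) (Q (p' t))) ^ 2 ≤ κ' * L' * ∑ t, ‖p t - p' t‖ ^ 2 := by
    refine h2.trans ?_
    gcongr with t
    exact hn2 t
  rw [hsplit]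
  nlinarith [sq_nonneg (∑ t, inner ℝ (e t) (P (p t - p' t)) + ∑ t, inner ℝ (e t) (Q (p' t)))]

/-! ### Real parts of matrices over `𝕜`, least squares and the basic inequality. -/

variable {𝕜 : Type*} [RCLike 𝕜]

/-- The coordinatewise real part, as a real linear map. -/
noncomputable def reMap (𝕜 : Type*) [RCLike 𝕜] (n : ℕ) : (Fin n → 𝕜) →ₗ[ℝ] EuclideanSpace ℝ (Fin n) where
  toFun v := WithLp.toLp 2 fun i => RCLike.re (v i)
  map_add' v w := by ext i; simp
  map_smul' a v := by ext i; simp [RCLike.smul_re]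

/-- The real parts of the vectors of a subspace. -/
noncomputable def reSpace {n : ℕ} (W : Submodule 𝕜 (Fin n → 𝕜)) : Submodule ℝ (EuclideanSpace ℝ (Fin n)) :=
  (W.restrictScalars ℝ).map (reMap 𝕜 n)

/-- The noise is real and sees only real parts, so real and complex scalars are treated together at
the cost of a factor `2 ≥ [𝕜 : ℝ]`. -/
lemma finrank_reSpace_le {n : ℕ} (W : Submodule 𝕜 (Fin n → 𝕜)) :
    Module.finrank ℝ (reSpace W) ≤ 2 * Module.finrank 𝕜 W := by
  have h := Module.finrank_mul_finrank ℝ 𝕜 W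
  have h2 := RCLike.finrank_le_two 𝕜
  have : Module.Finite ℝ (W.restrictScalars ℝ) := inferInstance
  calc _ ≤ Module.finrank ℝ (W.restrictScalars ℝ) := Submodule.finrank_map_le _ _
    _ = Module.finrank ℝ W := rfl
    _ = Module.finrank ℝ 𝕜 * Module.finrank 𝕜 W := h.symm
    _ ≤ _ := by gcongr

/-- The real parts of the linear combinations of the rows of a matrix. -/
noncomputable def reRowSpace {m n : ℕ} (Λ : Matrix (Fin m) (Fin n) 𝕜) :
    Submodule ℝ (EuclideanSpace ℝ (Fin n)) :=
  reSpace (LinearMap.range Λ.vecMulLinear)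

/-- The real parts of the linear combinations of the columns of a matrix. -/
noncomputable def reColSpace {m n : ℕ} (A : Matrix (Fin m) (Fin n) 𝕜) :
    Submodule ℝ (EuclideanSpace ℝ (Fin m)) :=
  reSpace (LinearMap.range A.mulVecLin)

lemma finrank_reRowSpace_le {m n : ℕ} (Λ : Matrix (Fin m) (Fin n) 𝕜) :
    Module.finrank ℝ (reRowSpace Λ) ≤ 2 * m := by
  refine (finrank_reSpace_le _).trans ?_
  gcongr
  exact (LinearMap.finrank_range_le _).trans (by simp)

lemma finrank_reColSpace_le {m n : ℕ} (A : Matrix (Fin m) (Fin n) 𝕜) :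
    Module.finrank ℝ (reColSpace A) ≤ 2 * A.rank :=
  finrank_reSpace_le _

/-- The real part of a column of a matrix. -/
noncomputable def reCol {m n : ℕ} (B : Matrix (Fin m) (Fin n) 𝕜) (t : Fin n) : EuclideanSpace ℝ (Fin m) :=
  reMap 𝕜 m (fun i => B i t)

@[simp] lemma reCol_apply {m n : ℕ} (B : Matrix (Fin m) (Fin n) 𝕜) (t : Fin n) (i : Fin m) :
    reCol B t i = RCLike.re (B i t) := rfl

lemma reCol_mul_mem {d m n : ℕ} (A : Matrix (Fin d) (Fin m) 𝕜) (Λ : Matrix (Fin m) (Fin n) 𝕜)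
    (t : Fin n) : reCol (A * Λ) t ∈ reColSpace A :=
  Submodule.mem_map_of_mem (p := (LinearMap.range A.mulVecLin).restrictScalars ℝ)
    ⟨fun j => Λ j t, by ext i; simp [Matrix.mulVec, Matrix.mul_apply, dotProduct]⟩

/-- As `u` is real, pairing with it commutes with real parts: the vector is the real part of `(u A)
Λ`. -/
lemma inner_reCol_mul_mem {d m n : ℕ} (A : Matrix (Fin d) (Fin m) 𝕜)
    (Λ : Matrix (Fin m) (Fin n) 𝕜) (u : EuclideanSpace ℝ (Fin d)) :
    WithLp.toLp 2 (fun t => inner ℝ u (reCol (A * Λ) t)) ∈ reRowSpace Λ := by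
  refine ⟨(fun i => ((u i : ℝ) : 𝕜)) ᵥ* (A * Λ),
    ⟨(fun i => ((u i : ℝ) : 𝕜)) ᵥ* A, by simp [Matrix.vecMul_vecMul]⟩, ?_⟩
  ext t
  simp [reMap, Matrix.vecMul, dotProduct, PiLp.inner_apply, mul_comm]

lemma frobNorm_sq {m n : ℕ} (A : Matrix (Fin m) (Fin n) 𝕜) :
    frobNorm A ^ 2 = ∑ i, ∑ j, ‖A i j‖ ^ 2 := by
  unfold frobNorm
  rw [Matrix.frobenius_norm_def, ← Real.rpow_natCast, ← Real.rpow_mul (by positivity)]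
  norm_num

lemma frobNorm_nonneg {m n : ℕ} (A : Matrix (Fin m) (Fin n) 𝕜) : 0 ≤ frobNorm A :=
  let := @Matrix.frobeniusNormedAddCommGroup (Fin m) (Fin n) 𝕜 _ _ _
  norm_nonneg A

lemma frobNorm_sub_le {m n : ℕ} (A B C : Matrix (Fin m) (Fin n) 𝕜) :
    frobNorm (A - B) ≤ frobNorm (A - C) + frobNorm (B - C) := by
  let := @Matrix.frobeniusNormedAddCommGroup (Fin m) (Fin n) 𝕜 _ _ _
  have := norm_sub_le (A - C) (B - C)
  rwa [sub_sub_sub_cancel_right] at this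

/-- The real Frobenius inner product of a real matrix with a matrix over `𝕜`. -/
def reInner {m n : ℕ} (E : Matrix (Fin m) (Fin n) ℝ) (B : Matrix (Fin m) (Fin n) 𝕜) : ℝ :=
  ∑ i, ∑ j, E i j * RCLike.re (B i j)

lemma reInner_sub {m n : ℕ} (E : Matrix (Fin m) (Fin n) ℝ) (A B : Matrix (Fin m) (Fin n) 𝕜) :
    reInner E (A - B) = reInner E A - reInner E B := by
  simp [reInner, mul_sub, Finset.sum_sub_distrib]

lemma frobNorm_sub_ofReal_add_sq {m n : ℕ} (B : Matrix (Fin m) (Fin n) 𝕜)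
    (M E : Matrix (Fin m) (Fin n) ℝ) :
    frobNorm (B - ofRealMatrix 𝕜 (M + E)) ^ 2 =
      frobNorm (B - ofRealMatrix 𝕜 M) ^ 2 - 2 * reInner E (B - ofRealMatrix 𝕜 M) +
        ∑ i, ∑ j, E i j ^ 2 := by
  simp only [frobNorm_sq, reInner, Finset.mul_sum, ← Finset.sum_sub_distrib,
    ← Finset.sum_add_distrib]
  refine Finset.sum_congr rfl fun i _ => Finset.sum_congr rfl fun j _ => ?_
  simp only [ofRealMatrix, Matrix.sub_apply, Matrix.map_apply, Matrix.add_apply,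
    ← RCLike.normSq_eq_def', RCLike.normSq_apply]
  simp
  ring

/-- `E` is bounded by `√L` as an operator on `W`. -/
def BoundedOn {m n : ℕ} (E : Matrix (Fin m) (Fin n) ℝ)
    (W : Submodule ℝ (EuclideanSpace ℝ (Fin n))) (L : ℝ) : Prop :=
  ∀ x ∈ W, ∑ i, (∑ t, E i t * x t) ^ 2 ≤ L * ‖x‖ ^ 2

/-- The matrix form of `sq_sum_inner_sub_le`. The constant `4` is its factor `2` times the doubling
of dimension under real parts. -/
lemma reInner_sq_le_of_boundedOn {d T m m' : ℕ} (E : Matrix (Fin d) (Fin T) ℝ)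
    (A : Matrix (Fin d) (Fin m) 𝕜) (A' : Matrix (Fin d) (Fin m') 𝕜)
    (Λ : Matrix (Fin m) (Fin T) 𝕜) (Λ' : Matrix (Fin m') (Fin T) 𝕜) (k k' : ℕ)
    (hA : A.rank ≤ k) (hA' : A'.rank ≤ k') (L L' : ℝ) (hL0 : 0 ≤ L) (hL0' : 0 ≤ L')
    (hL : BoundedOn E (reRowSpace Λ ⊔ reRowSpace Λ') L)
    (hL' : BoundedOn E (reRowSpace Λ') L') :
    reInner E (A * Λ - A' * Λ') ^ 2 ≤
      4 * (k * L + k' * L') * frobNorm (A * Λ - A' * Λ') ^ 2 := by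
  set e : Fin T → EuclideanSpace ℝ (Fin d) := fun t => WithLp.toLp 2 fun i => E i t
  have hE : ∀ x : EuclideanSpace ℝ (Fin T),
      ‖∑ t, x t • e t‖ ^ 2 = ∑ i, (∑ t, E i t * x t) ^ 2 := by
    intro x
    rw [EuclideanSpace.norm_sq_eq]
    refine Finset.sum_congr rfl fun i _ => ?_
    simp [e, mul_comm]
  have h := sq_sum_inner_sub_le e (reCol (A * Λ)) (reCol (A' * Λ')) (reColSpace A)
    (reColSpace A') (reRowSpace Λ) (reRowSpace Λ') L L' hL0 hL0' (2 * k) (2 * k')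
    (by exact_mod_cast (finrank_reColSpace_le A).trans (by gcongr))
    (by exact_mod_cast (finrank_reColSpace_le A').trans (by gcongr))
    (fun x hx => by rw [hE]; exact hL x hx) (fun x hx => by rw [hE]; exact hL' x hx)
    (reCol_mul_mem A Λ) (reCol_mul_mem A' Λ') (inner_reCol_mul_mem A Λ)
    (inner_reCol_mul_mem A' Λ')
  have h1 : ∑ t, inner ℝ (e t) (reCol (A * Λ) t - reCol (A' * Λ') t) =
      reInner E (A * Λ - A' * Λ') := by
    unfold reInner
    rw [Finset.sum_comm]
    refine Finset.sum_congr rfl fun t _ => ?_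
    simp [PiLp.inner_apply, e, mul_comm]
  have h2 : ∑ t, ‖reCol (A * Λ) t - reCol (A' * Λ') t‖ ^ 2 ≤
      frobNorm (A * Λ - A' * Λ') ^ 2 := by
    rw [frobNorm_sq, Finset.sum_comm]
    gcongr with t
    rw [EuclideanSpace.norm_sq_eq]
    gcongr with i
    rw [PiLp.sub_apply, reCol_apply, reCol_apply, ← map_sub]
    exact RCLike.norm_re_le_norm _
  rw [h1] at h
  refine h.trans ?_
  calc _ ≤ 2 * (2 * k * L + 2 * k' * L') * frobNorm (A * Λ - A' * Λ') ^ 2 := by gcongr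
    _ = _ := by ring

lemma frobNorm_sq_eq_trace {m n : ℕ} (A : Matrix (Fin m) (Fin n) 𝕜) :
    frobNorm A ^ 2 = RCLike.re (A * Aᴴ).trace := by
  rw [frobNorm_sq]
  simp [Matrix.trace, Matrix.mul_apply, RCLike.mul_conj]

/-- Pythagoras: `X Λ⁺ Λ` projects the rows of `X` onto the row space of `Λ`, and `Λ` acts on row
vectors as `√c` times an isometry. Hence minimizing `‖A - X Λ⁺‖` is minimizing `‖A Λ - X‖`. -/
lemma frobNorm_mul_sub_sq {d m n : ℕ} (Λ : Matrix (Fin m) (Fin n) 𝕜) (c : ℝ) (hc : 0 < c)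
    (hΛ : Λ * Λᴴ = (c : 𝕜) • (1 : Matrix (Fin m) (Fin m) 𝕜)) (A : Matrix (Fin d) (Fin m) 𝕜)
    (X : Matrix (Fin d) (Fin n) 𝕜) :
    frobNorm (A * Λ - X) ^ 2 =
      c * frobNorm (A - X * pseudoInv Λ) ^ 2 + frobNorm (X * pseudoInv Λ * Λ - X) ^ 2 := by
  have hc' : (c : 𝕜) ≠ 0 := by exact_mod_cast hc.ne'
  have hp : pseudoInv Λ = (c : 𝕜)⁻¹ • Λᴴ := by
    unfold pseudoInv
    have hinv : ((c : 𝕜) • (1 : Matrix (Fin m) (Fin m) 𝕜))⁻¹ = (c : 𝕜)⁻¹ • 1 :=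
      Matrix.inv_eq_right_inv (by rw [Matrix.smul_mul, Matrix.one_mul, smul_inv_smul₀ hc'])
    rw [hΛ, hinv, Matrix.mul_smul, Matrix.mul_one]
  have horth : (X * pseudoInv Λ * Λ - X) * Λᴴ = 0 := by
    rw [Matrix.sub_mul, Matrix.mul_assoc, hΛ, hp, Matrix.mul_smul, Matrix.mul_smul,
      Matrix.mul_one, smul_inv_smul₀ hc', sub_self]
  have horth' : Λ * (X * pseudoInv Λ * Λ - X)ᴴ = 0 := by
    have := congrArg Matrix.conjTranspose horth
    simpa [Matrix.conjTranspose_mul] using this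
  have hdec : A * Λ - X = (A - X * pseudoInv Λ) * Λ + (X * pseudoInv Λ * Λ - X) := by
    rw [Matrix.sub_mul]; abel
  set C := A - X * pseudoInv Λ
  set Y := X * pseudoInv Λ * Λ - X
  rw [hdec, frobNorm_sq_eq_trace, frobNorm_sq_eq_trace, frobNorm_sq_eq_trace,
    Matrix.conjTranspose_add, Matrix.conjTranspose_mul, Matrix.add_mul, Matrix.mul_add,
    Matrix.mul_add, ← Matrix.mul_assoc Y, horth, Matrix.mul_assoc C, Matrix.mul_assoc C,
    ← Matrix.mul_assoc Λ, hΛ, horth', Matrix.smul_mul, Matrix.one_mul, Matrix.mul_smul,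
    Matrix.mul_zero, Matrix.zero_mul, add_zero, zero_add, Matrix.trace_add, Matrix.trace_smul,
    map_add, smul_eq_mul, RCLike.re_ofReal_mul]

lemma IsERM.frobNorm_mul_sub_le {d T τ : ℕ} {Λ : Matrix (Fin τ) (Fin T) 𝕜}
    {S : Set (Matrix (Fin d) (Fin τ) 𝕜)} {X : Matrix (Fin d) (Fin T) ℝ}
    {A : Matrix (Fin d) (Fin τ) 𝕜} (h : IsERM Λ S X A)
    (hΛ : ∃ c : ℝ, 0 < c ∧ Λ * Λᴴ = (c : 𝕜) • (1 : Matrix (Fin τ) (Fin τ) 𝕜))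
    {B : Matrix (Fin d) (Fin τ) 𝕜} (hB : B ∈ S) :
    frobNorm (A * Λ - ofRealMatrix 𝕜 X) ^ 2 ≤ frobNorm (B * Λ - ofRealMatrix 𝕜 X) ^ 2 := by
  obtain ⟨c, hc, hΛ⟩ := hΛ
  rw [frobNorm_mul_sub_sq Λ c hc hΛ A, frobNorm_mul_sub_sq Λ c hc hΛ B]
  have : frobNorm (A - ofRealMatrix 𝕜 X * pseudoInv Λ) ^ 2 ≤
    frobNorm (B - ofRealMatrix 𝕜 X * pseudoInv Λ) ^ 2 := h.2 hB
  gcongr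

/-- The oracle inequality, given a bound `N` for the noise on the relevant directions. -/
lemma oracle_of_noise_bound {d T : ℕ} (M E : Matrix (Fin d) (Fin T) ℝ)
    (B A : Matrix (Fin d) (Fin T) 𝕜) (lam N pen pen' : ℝ) (h0 : 0 < lam)
    (hmin : frobNorm (B - ofRealMatrix 𝕜 (M + E)) ^ 2 + pen' ≤
      frobNorm (A - ofRealMatrix 𝕜 (M + E)) ^ 2 + pen)
    (hN : reInner E (B - A) ^ 2 ≤ N * frobNorm (B - A) ^ 2) (hN0 : 0 ≤ N) :
    (1 - lam) * frobNorm (B - ofRealMatrix 𝕜 M) ^ 2 ≤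
      (1 + lam) * frobNorm (A - ofRealMatrix 𝕜 M) ^ 2 + 2 * N / lam + pen - pen' := by
  rw [frobNorm_sub_ofReal_add_sq, frobNorm_sub_ofReal_add_sq] at hmin
  have hsub : reInner E (B - A) =
      reInner E (B - ofRealMatrix 𝕜 M) - reInner E (A - ofRealMatrix 𝕜 M) := by
    rw [← reInner_sub, sub_sub_sub_cancel_right]
  have htri := frobNorm_sub_le B A (ofRealMatrix 𝕜 M)
  have hBA := frobNorm_nonneg (B - A)
  set a := frobNorm (B - ofRealMatrix 𝕜 M)
  set b := frobNorm (A - ofRealMatrix 𝕜 M)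
  set f := frobNorm (B - A)
  have hle : reInner E (B - A) ≤ √N * f := by
    rw [← Real.sqrt_sq hBA, ← Real.sqrt_mul hN0]
    exact Real.le_sqrt_of_sq_le hN
  have hfin : 2 * (√N * f) ≤ lam * (a ^ 2 + b ^ 2) + 2 * N / lam := by
    have hf : f ^ 2 ≤ 2 * (a ^ 2 + b ^ 2) := by nlinarith [sq_nonneg (a - b)]
    have hs : √N ^ 2 = N := Real.sq_sqrt hN0
    -- The weight `lam / 2` turns `f² ≤ 2(a² + b²)` into exactly `lam (a² + b²)`.
    have hy : 2 * (√N * f) ≤ lam / 2 * f ^ 2 + 2 * N / lam := by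
      have : lam / 2 * f ^ 2 + 2 * N / lam - 2 * (√N * f) = (lam * f - 2 * √N) ^ 2 / (2 * lam) := by
        nth_rewrite 1 [← hs]
        field_simp
        ring
      have h2 : 0 ≤ (lam * f - 2 * √N) ^ 2 / (2 * lam) := by positivity
      linarith
    nlinarith
  linarith

end Deterministic

end TimeSeriesFactorization

namespace TimeSeriesFactorization

/-! ### Concentration of the noise on a fixed subspace. -/

section Concentration

variable {Ω : Type*} [MeasurableSpace Ω] {μ : Measure Ω}

lemma lintegral_pow_le_of_eLpNorm_le {Z : Ω → ℝ} {G : ℝ} (hG : 0 < G)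
    (hp : ∀ p : ℝ, 1 ≤ p → eLpNorm Z (ENNReal.ofReal p) μ ≤ ENNReal.ofReal √(p * G))
    {n : ℕ} (hn : n ≠ 0) :
    ∫⁻ ω, ENNReal.ofReal ((Z ω ^ 2) ^ n) ∂μ ≤ ENNReal.ofReal ((2 * n * G) ^ n) := by
  have hn1 : (1 : ℝ) ≤ n := by exact_mod_cast Nat.one_le_iff_ne_zero.2 hn
  have h2n : (0 : ℝ) < 2 * n := by positivity
  have h := hp (2 * n) (by linarith)
  rw [eLpNorm_eq_lintegral_rpow_enorm_toReal (by simpa using hn)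
    ENNReal.ofReal_ne_top,
    ENNReal.toReal_ofReal h2n.le] at h
  have h2 := ENNReal.rpow_le_rpow h h2n.le
  rw [← ENNReal.rpow_mul, one_div_mul_cancel h2n.ne', ENNReal.rpow_one,
    ENNReal.ofReal_rpow_of_nonneg (Real.sqrt_nonneg _) h2n.le] at h2
  have hl : ∀ ω, ENNReal.ofReal ((Z ω ^ 2) ^ n) = ‖Z ω‖ₑ ^ (2 * n : ℝ) := fun ω => by
    rw [Real.enorm_eq_ofReal_abs, ENNReal.ofReal_rpow_of_nonneg (abs_nonneg _) h2n.le]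
    congr 1
    rw [Real.rpow_mul (abs_nonneg _), Real.rpow_natCast]
    norm_num
  have hr : √(2 * n * G) ^ (2 * n : ℝ) = (2 * n * G) ^ n := by
    rw [Real.rpow_mul (Real.sqrt_nonneg _), Real.rpow_natCast, Real.rpow_two,
      Real.sq_sqrt (by positivity)]
  simp_rw [hl]
  rwa [hr] at h2

/-- Expand the exponential: since `E Z^(2n) ≤ (2nG)^n` and `n^n / n! ≤ e^n`, the scale `4eG` makes
the `n`-th term at most `2^(-n)`. No centring is needed. -/
lemma lintegral_exp_sq_le_two [IsProbabilityMeasure μ] {Z : Ω → ℝ} (hZ : Measurable Z) {G : ℝ}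
    (hG : 0 < G)
    (hp : ∀ p : ℝ, 1 ≤ p → eLpNorm Z (ENNReal.ofReal p) μ ≤ ENNReal.ofReal √(p * G)) :
    ∫⁻ ω, ENNReal.ofReal (Real.exp (Z ω ^ 2 / (4 * Real.exp 1 * G))) ∂μ ≤ 2 := by
  set θ : ℝ := 1 / (4 * Real.exp 1 * G)
  have hθ : 0 < θ := by positivity
  have hexp : ∀ ω, ENNReal.ofReal (Real.exp (Z ω ^ 2 / (4 * Real.exp 1 * G))) =
      ∑' n : ℕ, ENNReal.ofReal (θ ^ n / n.factorial) * ENNReal.ofReal ((Z ω ^ 2) ^ n) := by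
    intro ω
    have h1 := Real.summable_pow_div_factorial (Z ω ^ 2 / (4 * Real.exp 1 * G))
    have h2 : Real.exp (Z ω ^ 2 / (4 * Real.exp 1 * G)) =
        ∑' n : ℕ, (Z ω ^ 2 / (4 * Real.exp 1 * G)) ^ n / n.factorial :=
      (congrFun Real.exp_eq_exp_ℝ _).trans (congrFun NormedSpace.exp_eq_tsum_div _)
    rw [h2, ENNReal.ofReal_tsum_of_nonneg (fun n => by positivity) h1]
    refine tsum_congr fun n => ?_
    rw [← ENNReal.ofReal_mul (by positivity)]
    congr 1
    simp only [θ, div_pow, one_pow]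
    ring
  simp_rw [hexp]
  rw [lintegral_tsum (fun n => by fun_prop)]
  calc _ ≤ ∑' n : ℕ, (2⁻¹ : ℝ≥0∞) ^ n := by
        refine ENNReal.tsum_le_tsum fun n => ?_
        rw [lintegral_const_mul _ (by fun_prop)]
        rcases eq_or_ne n 0 with rfl | hn
        · simp
        · calc _ ≤ ENNReal.ofReal (θ ^ n / n.factorial) * ENNReal.ofReal ((2 * n * G) ^ n) := by
                gcongr
                exact lintegral_pow_le_of_eLpNorm_le hG hp hn
            _ = ENNReal.ofReal (((n : ℝ) ^ n / n.factorial) * (2 * θ * G) ^ n) := by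
                rw [← ENNReal.ofReal_mul (by positivity)]
                congr 1
                simp only [mul_pow]
                ring
            _ ≤ ENNReal.ofReal (Real.exp n * (2 * θ * G) ^ n) := by
                gcongr
                exact Real.pow_div_factorial_le_exp _ (by positivity) _
            _ = ENNReal.ofReal (2⁻¹ ^ n) := by
                congr 1
                rw [← Real.exp_one_pow, ← mul_pow]
                congr 1
                simp only [θ]
                field_simp
                norm_num
            _ = _ := by
                rw [ENNReal.ofReal_pow (by norm_num), ENNReal.ofReal_inv_of_pos (by norm_num)]
                simp
    _ = 2 := by simp

/-- By independence the exponential moment of the sum is at most `2^d ≤ e^d`; Markov's inequality at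
level `e^(d + v)` leaves `e^(-v)`. -/
lemma measure_sum_sq_ge_le [IsProbabilityMeasure μ] {d : ℕ} {Z : Fin d → Ω → ℝ}
    (hZ : ∀ i, Measurable (Z i)) (hind : iIndepFun Z μ) {G : ℝ} (hG : 0 < G)
    (hp : ∀ i, ∀ p : ℝ, 1 ≤ p →
      eLpNorm (Z i) (ENNReal.ofReal p) μ ≤ ENNReal.ofReal √(p * G)) (v : ℝ) :
    μ {ω | 4 * Real.exp 1 * G * (d + v) ≤ ∑ i, Z i ω ^ 2} ≤ ENNReal.ofReal (Real.exp (-v)) := by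
  have he := Real.exp_pos 1
  have hGe : 0 < 4 * Real.exp 1 * G := by positivity
  set f : ℝ → ℝ≥0∞ := fun z => ENNReal.ofReal (Real.exp (z ^ 2 / (4 * Real.exp 1 * G)))
  have hf : Measurable f := by fun_prop
  have hprod : ∀ ω, ∏ i, f (Z i ω) =
      ENNReal.ofReal (Real.exp ((∑ i, Z i ω ^ 2) / (4 * Real.exp 1 * G))) := fun ω => by
    rw [Finset.sum_div, Real.exp_sum, ENNReal.ofReal_prod_of_nonneg
      (fun i _ => (Real.exp_pos _).le)]
  have hint : ∫⁻ ω, ∏ i, f (Z i ω) ∂μ ≤ 2 ^ d := by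
    have := lintegral_prod_eq_prod_lintegral_of_indepFun Finset.univ (fun i ω => f (Z i ω))
      (hind.comp (fun _ => f) (fun _ => hf)) (fun i => hf.comp (hZ i))
    rw [this]
    calc _ ≤ ∏ i : Fin d, (2 : ℝ≥0∞) :=
          Finset.prod_le_prod' fun i _ => lintegral_exp_sq_le_two (hZ i) hG (hp i)
      _ = _ := by simp
  have hmk := meas_ge_le_lintegral_div (μ := μ) (f := fun ω => ∏ i, f (Z i ω))
    (by fun_prop) (ε := ENNReal.ofReal (Real.exp (d + v)))
    (by simpa using Real.exp_pos _) (by simp)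
  calc _ ≤ μ {ω | ENNReal.ofReal (Real.exp (d + v)) ≤ ∏ i, f (Z i ω)} := by
        refine measure_mono fun ω hω => ?_
        simp only [Set.mem_ofPred_eq] at hω ⊢
        rw [hprod]
        gcongr
        rw [le_div_iff₀ hGe]
        linarith
    _ ≤ _ := hmk
    _ ≤ 2 ^ d / ENNReal.ofReal (Real.exp (d + v)) := by gcongr
    _ = ENNReal.ofReal (2 ^ d / Real.exp (d + v)) := by
        rw [ENNReal.ofReal_div_of_pos (Real.exp_pos _), ENNReal.ofReal_pow (by norm_num)]
        simp
    _ ≤ _ := by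
        gcongr
        rw [div_le_iff₀ (Real.exp_pos _), ← Real.exp_add]
        have h2 : (2 : ℝ) ≤ Real.exp 1 := by
          have := Real.add_one_le_exp 1
          linarith
        calc (2 : ℝ) ^ d ≤ Real.exp 1 ^ d := by gcongr
          _ = Real.exp (-v + (d + v)) := by rw [Real.exp_one_pow]; congr 1; ring

/-- A finite set of at most `5 ^ dim` points of the ball of radius `2` controls the norm of every
linear map. -/
lemma exists_finset_norm_le (V F : Type*) [NormedAddCommGroup V] [NormedSpace ℝ V]
    [FiniteDimensional ℝ V] [NormedAddCommGroup F] [NormedSpace ℝ F] :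
    ∃ s : Finset V, s.card ≤ 5 ^ Module.finrank ℝ V ∧ (∀ c ∈ s, ‖c‖ ≤ 2) ∧
      ∀ (f : V →ₗ[ℝ] F) (r : ℝ), 0 ≤ r → (∀ c ∈ s, ‖f c‖ ≤ r) → ∀ x, ‖f x‖ ≤ r * ‖x‖ := by
  classical
  let P : Finset V → Prop := fun s =>
    (∀ c ∈ s, ‖c‖ ≤ 2) ∧ ∀ c ∈ s, ∀ d ∈ s, c ≠ d → 1 ≤ ‖c - d‖
  have hcard : ∀ s, P s → s.card ≤ 5 ^ Module.finrank ℝ V := fun s hs =>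
    Besicovitch.card_le_of_separated s hs.1 hs.2
  -- A 1-separated set of maximal cardinality in the ball of radius `2` is a 1-net of that ball.
  obtain ⟨s, hs, hmax⟩ : ∃ s, P s ∧ ∀ t, P t → t.card ≤ s.card := by
    let Q : ℕ → Prop := fun n => ∃ s, P s ∧ s.card = n
    have h0 : Q 0 := ⟨∅, by simp [P], rfl⟩
    obtain ⟨s, hs, hc⟩ := Nat.findGreatest_spec (P := Q) (Nat.zero_le (5 ^ Module.finrank ℝ V)) h0
    refine ⟨s, hs, fun t ht => ?_⟩
    rw [hc]
    exact Nat.le_findGreatest (hcard t ht) ⟨t, ht, rfl⟩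
  refine ⟨s, hcard s hs, hs.1, fun f r hr hf => ?_⟩
  have hnet : ∀ x : V, ‖x‖ ≤ 2 → ∃ c ∈ s, ‖x - c‖ ≤ 1 := by
    intro x hx
    by_contra! hcon
    have hxs : x ∉ s := fun h => by
      have := hcon x h
      norm_num at this
    have := hmax (insert x s) ⟨by
      intro c hc
      rcases Finset.mem_insert.1 hc with rfl | hc
      · exact hx
      · exact hs.1 c hc, by
      intro c hc d hd hcd
      rcases Finset.mem_insert.1 hc with rfl | hc' <;> rcases Finset.mem_insert.1 hd with rfl | hd'
      · exact absurd rfl hcd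
      · exact (hcon d hd').le
      · rw [norm_sub_rev]; exact (hcon c hc').le
      · exact hs.2 c hc' d hd' hcd⟩
    rw [Finset.card_insert_of_notMem hxs] at this
    omega
  set g := LinearMap.toContinuousLinearMap f
  have hg : ∀ x, f x = g x := fun x => rfl
  have hN : ‖g‖ ≤ r := by
    -- Rescaled to norm `2`, a vector lies within `1` of the net; the error `‖g‖` is then absorbed
    -- on the left.
    have : ‖g‖ ≤ (r + ‖g‖) / 2 := by
      refine g.opNorm_le_bound (by positivity) fun x => ?_
      rcases eq_or_ne x 0 with rfl | hx
      · simp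
      have hx0 : 0 < ‖x‖ := norm_pos_iff.2 hx
      obtain ⟨c, hc, hxc⟩ := hnet ((2 / ‖x‖) • x) (by
        rw [norm_smul, norm_div, norm_norm]
        field_simp
        norm_num)
      have h1 : ‖g ((2 / ‖x‖) • x)‖ ≤ r + ‖g‖ := by
        calc _ = ‖g c + g ((2 / ‖x‖) • x - c)‖ := by rw [← map_add]; congr 2; abel
          _ ≤ ‖g c‖ + ‖g ((2 / ‖x‖) • x - c)‖ := norm_add_le _ _
          _ ≤ r + ‖g‖ * 1 := by
              gcongr
              · exact hf c hc
              · exact (g.le_opNorm _).trans (by gcongr)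
          _ = _ := by ring
      rw [map_smul, norm_smul, norm_div, norm_norm, Real.norm_ofNat] at h1
      have h2 : ‖g x‖ = (2 / ‖x‖ * ‖g x‖) * (‖x‖ / 2) := by field_simp
      rw [h2]
      calc _ ≤ (r + ‖g‖) * (‖x‖ / 2) := by gcongr
        _ = _ := by ring
    linarith
  intro x
  rw [hg]
  exact (g.le_opNorm x).trans (by gcongr)

/-- With high probability, a random matrix with independent sub-Gaussian rows is bounded on a
given subspace. -/
lemma exists_event_boundedOn [IsProbabilityMeasure μ] {d T : ℕ}
    {ε : Ω → Matrix (Fin d) (Fin T) ℝ} (hmeas : ∀ i, Measurable (fun ω => ε ω i))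
    (hind : iIndepFun (fun (i : Fin d) (ω : Ω) => ε ω i) μ) {G : ℝ} (hG : 0 < G)
    (hp : ∀ (x : EuclideanSpace ℝ (Fin T)) (i : Fin d) (p : ℝ), 1 ≤ p →
      eLpNorm (fun ω => ∑ t, ε ω i t * x t) (ENNReal.ofReal p) μ ≤
        ENNReal.ofReal √(p * (G * ‖x‖ ^ 2)))
    (W : Submodule ℝ (EuclideanSpace ℝ (Fin T))) {D : ℕ} (hD : Module.finrank ℝ W ≤ D)
    {u : ℝ} (hu : 0 ≤ u) :
    ∃ E : Set Ω, MeasurableSet E ∧ μ Eᶜ ≤ ENNReal.ofReal (Real.exp (-u)) ∧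
      ∀ ω ∈ E, BoundedOn (ε ω) W (16 * Real.exp 1 * G * (d + 2 * D + u)) := by
  obtain ⟨s, hcard, hs2, hs⟩ := exists_finset_norm_le W (EuclideanSpace ℝ (Fin d))
  -- Net points have norm up to `2`, which turns `4eG` into `16eG`; the term `2 * D` pays for the
  -- `5^D ≤ e^(2D)` points.
  set R : ℝ := 16 * Real.exp 1 * G * (d + 2 * D + u)
  have hR : 0 ≤ R := by positivity
  have hZ : ∀ (x : EuclideanSpace ℝ (Fin T)) (i : Fin d),
      Measurable (fun ω => ∑ t, ε ω i t * x t) := fun x i =>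
    Finset.measurable_sum _ fun t _ => ((measurable_pi_apply t).comp (hmeas i)).mul_const _
  have hQm : ∀ x : EuclideanSpace ℝ (Fin T),
      Measurable (fun ω => ∑ i, (∑ t, ε ω i t * x t) ^ 2) := fun x =>
    Finset.measurable_sum _ fun i _ => (hZ x i).pow_const 2
  set bad : W → Set Ω := fun c =>
    {ω | R ≤ ∑ i, (∑ t, ε ω i t * (c : EuclideanSpace ℝ (Fin T)) t) ^ 2}
  have hbm : ∀ c, MeasurableSet (bad c) := fun c => measurableSet_le measurable_const (hQm c)
  have hbad : ∀ c ∈ s, μ (bad c) ≤ ENNReal.ofReal (Real.exp (-(u + 2 * D))) := by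
    intro c hc
    have h := measure_sum_sq_ge_le (μ := μ)
      (Z := fun i ω => ∑ t, ε ω i t * (c : EuclideanSpace ℝ (Fin T)) t) (hZ c)
      (hind.comp (fun _ r => ∑ t, r t * (c : EuclideanSpace ℝ (Fin T)) t)
        (fun _ => Finset.measurable_sum _ fun t _ => (measurable_pi_apply t).mul_const _))
      (G := G * 4) (by positivity) (fun i p hp1 => (hp c i p hp1).trans (by
        have : ‖(c : EuclideanSpace ℝ (Fin T))‖ ≤ 2 := hs2 c hc
        gcongr
        nlinarith [norm_nonneg (c : EuclideanSpace ℝ (Fin T))])) (u + 2 * D)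
    have hRe : R = 4 * Real.exp 1 * (G * 4) * (d + (u + 2 * D)) := by simp only [R]; ring
    simp only [bad, hRe]
    exact h
  refine ⟨(⋃ c ∈ s, bad c)ᶜ, (Finset.measurableSet_biUnion s fun c _ => hbm c).compl, ?_, ?_⟩
  · rw [compl_compl]
    calc _ ≤ ∑ c ∈ s, μ (bad c) := measure_biUnion_finset_le _ _
      _ ≤ ∑ c ∈ s, ENNReal.ofReal (Real.exp (-(u + 2 * D))) := Finset.sum_le_sum hbad
      _ = ENNReal.ofReal (s.card * Real.exp (-(u + 2 * D))) := by
          rw [Finset.sum_const, nsmul_eq_mul, ENNReal.ofReal_mul (by positivity),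
            ENNReal.ofReal_natCast]
      _ ≤ _ := by
          gcongr
          have h5 : (5 : ℝ) ≤ Real.exp 2 := by
            have h1 : (2.7 : ℝ) ≤ Real.exp 1 := by
              have := Real.exp_one_gt_d9
              linarith
            have : Real.exp 2 = Real.exp 1 * Real.exp 1 := by rw [← Real.exp_add]; norm_num
            rw [this]
            nlinarith
          have hc : (s.card : ℝ) ≤ Real.exp (2 * D) := by
            calc (s.card : ℝ) ≤ 5 ^ Module.finrank ℝ W := by exact_mod_cast hcard
              _ ≤ 5 ^ D := by gcongr; norm_num
              _ ≤ Real.exp 2 ^ D := by gcongr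
              _ = Real.exp (2 * D) := by rw [← Real.exp_nat_mul]; congr 1; ring
          calc _ ≤ Real.exp (2 * D) * Real.exp (-(u + 2 * D)) := by gcongr
            _ = _ := by rw [← Real.exp_add]; congr 1; ring
  · intro ω hω x hx
    let f : W →ₗ[ℝ] EuclideanSpace ℝ (Fin d) :=
      (Matrix.toEuclideanLin (ε ω)).comp W.subtype
    have hf : ∀ c : W, ‖f c‖ ^ 2 =
        ∑ i, (∑ t, ε ω i t * (c : EuclideanSpace ℝ (Fin T)) t) ^ 2 := fun c => by
      rw [EuclideanSpace.norm_sq_eq]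
      refine Finset.sum_congr rfl fun i _ => ?_
      rw [Real.norm_eq_abs, sq_abs]
      rfl
    have h1 := hs f √R (Real.sqrt_nonneg _) (fun c hc => by
      refine Real.le_sqrt_of_sq_le ?_
      rw [hf]
      simp only [Set.mem_compl_iff, Set.mem_iUnion, not_exists] at hω
      have := hω c hc
      simp only [bad, Set.mem_ofPred_eq, not_le] at this
      exact this.le) ⟨x, hx⟩
    have h2 := pow_le_pow_left₀ (norm_nonneg _) h1 2
    rw [hf, mul_pow, Real.sq_sqrt hR] at h2
    exact h2

end Concentration

/-! ### Moment bounds for the noise from those of its whitened row. -/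

section Whitening

variable {Ω : Type*} [MeasurableSpace Ω] {μ : Measure Ω}

lemma eLpNorm_le_of_subGaussianNorm {n : ℕ} (η : Ω → Fin n → ℝ) {K : ℝ}
    (hK : subGaussianNorm μ η ≤ ENNReal.ofReal K) (y : EuclideanSpace ℝ (Fin n)) {p : ℝ}
    (hp : 1 ≤ p) :
    eLpNorm (fun ω => ∑ t, η ω t * y t) (ENNReal.ofReal p) μ ≤
      ENNReal.ofReal (√p * K * ‖y‖) := by
  rcases eq_or_ne y 0 with rfl | hy
  · simp
  have hy0 : 0 < ‖y‖ := norm_pos_iff.2 hy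
  have hp0 : 0 < p := by linarith
  set x : EuclideanSpace ℝ (Fin n) := ‖y‖⁻¹ • y
  have hx : ‖x‖ = 1 := by
    simp only [x, norm_smul, norm_inv, norm_norm]
    field_simp
  have h1 : ENNReal.ofReal (p ^ (-(1 / 2) : ℝ)) *
      eLpNorm (fun ω => ∑ t, η ω t * x t) (ENNReal.ofReal p) μ ≤ ENNReal.ofReal K := by
    refine le_trans ?_ hK
    unfold subGaussianNorm
    exact le_iSup₂_of_le x hx (le_iSup₂_of_le p hp le_rfl)
  have hfun : (fun ω => ∑ t, η ω t * y t) = ‖y‖ • fun ω => ∑ t, η ω t * x t := by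
    ext ω
    simp only [x, Pi.smul_apply, smul_eq_mul, Finset.mul_sum, PiLp.smul_apply]
    refine Finset.sum_congr rfl fun t _ => ?_
    field_simp
  have hsq : ENNReal.ofReal √p * ENNReal.ofReal (p ^ (-(1 / 2) : ℝ)) = 1 := by
    rw [← ENNReal.ofReal_mul (Real.sqrt_nonneg _), Real.sqrt_eq_rpow, ← Real.rpow_add hp0]
    simp
  rw [hfun, eLpNorm_const_smul]
  calc _ = ‖‖y‖‖ₑ * (ENNReal.ofReal √p * (ENNReal.ofReal (p ^ (-(1 / 2) : ℝ)) *
        eLpNorm (fun ω => ∑ t, η ω t * x t) (ENNReal.ofReal p) μ)) := by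
        rw [← mul_assoc (ENNReal.ofReal √p), hsq, one_mul]
    _ ≤ ‖‖y‖‖ₑ * (ENNReal.ofReal √p * ENNReal.ofReal K) := by gcongr
    _ = _ := by
        rw [Real.enorm_eq_ofReal_abs, abs_norm, ← ENNReal.ofReal_mul (Real.sqrt_nonneg _),
          ← ENNReal.ofReal_mul (norm_nonneg _)]
        congr 1
        ring

open scoped MatrixOrder Matrix.Norms.L2Operator in
/-- An invertible matrix `R` with `‖R x‖² ≤ ‖S‖ ‖x‖²` and inverse `invSqrt S`. -/
lemma exists_sqrt_of_invSqrt_ne_zero {n : ℕ} {S : Matrix (Fin n) (Fin n) ℝ}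
    (h : invSqrt S ≠ 0) :
    ∃ R : Matrix (Fin n) (Fin n) ℝ, invSqrt S * R = 1 ∧
      ∀ x : EuclideanSpace ℝ (Fin n), ‖WithLp.toLp 2 (R *ᵥ x)‖ ^ 2 ≤ opNorm S * ‖x‖ ^ 2 := by
  set R := CFC.sqrt S with hRdef
  have hinv : invSqrt S = R⁻¹ := rfl
  -- A singular root, or a matrix `S` that is not positive semidefinite, would give `invSqrt S` the
  -- default value `0`.
  have hdet : IsUnit R.det := by
    by_contra hd
    exact h (by rw [hinv, Matrix.nonsing_inv_apply_not_isUnit _ hd])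
  have hS : 0 ≤ S := by
    by_contra hS
    apply h
    rw [hinv, hRdef, CFC.sqrt_of_not_nonneg hS, Matrix.inv_zero]
  have hRR : R * R = S := CFC.sqrt_mul_sqrt_self S hS
  have hRp : R.PosSemidef := Matrix.nonneg_iff_posSemidef.1 (CFC.sqrt_nonneg S)
  refine ⟨R, by rw [hinv, Matrix.nonsing_inv_mul _ hdet], fun x => ?_⟩
  have hRt : Rᵀ = R := by
    have := hRp.isHermitian.eq
    rwa [Matrix.conjTranspose_eq_transpose_of_trivial] at this
  have h1 : ‖WithLp.toLp 2 (R *ᵥ x)‖ ^ 2 =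
      inner ℝ x (Matrix.toEuclideanCLM (n := Fin n) (𝕜 := ℝ) S x) := by
    rw [← real_inner_self_eq_norm_sq]
    have e1 : inner ℝ (WithLp.toLp 2 (R *ᵥ x)) (WithLp.toLp 2 (R *ᵥ x) : EuclideanSpace ℝ (Fin n))
      = (R *ᵥ x) ⬝ᵥ (R *ᵥ x) := by
      rw [PiLp.inner_apply]
      simp [dotProduct, pow_two]
    have e2 : inner ℝ x (Matrix.toEuclideanCLM (n := Fin n) (𝕜 := ℝ) S x) =
        (x : Fin n → ℝ) ⬝ᵥ (S *ᵥ x) := by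
      simp [PiLp.inner_apply, dotProduct, mul_comm]
    rw [e1, e2, ← hRR, ← Matrix.mulVec_mulVec, Matrix.dotProduct_mulVec _ R (R *ᵥ x),
      ← Matrix.mulVec_transpose, hRt]
  rw [h1]
  calc _ ≤ ‖x‖ * ‖Matrix.toEuclideanCLM (n := Fin n) (𝕜 := ℝ) S x‖ := real_inner_le_norm _ _
    _ ≤ ‖x‖ * (opNorm S * ‖x‖) := by
        gcongr
        exact (Matrix.toEuclideanCLM (n := Fin n) (𝕜 := ℝ) S).le_opNorm x
    _ = _ := by ring

lemma opNorm_nonneg {n : ℕ} (S : Matrix (Fin n) (Fin n) ℝ) : 0 ≤ opNorm S := norm_nonneg _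

lemma opNorm_pos_of_ne_zero {n : ℕ} {S : Matrix (Fin n) (Fin n) ℝ} (h : S ≠ 0) :
    0 < opNorm S := by
  refine norm_pos_iff.2 fun h0 => h ?_
  exact (EmbeddingLike.map_eq_zero_iff (f := Matrix.toEuclideanCLM (n := Fin n) (𝕜 := ℝ))).1 h0

lemma invSqrt_zero {n : ℕ} : invSqrt (0 : Matrix (Fin n) (Fin n) ℝ) = 0 := by
  simp [invSqrt]

namespace SubGaussianNoise

variable {d T : ℕ} [NeZero d] {ε : Ω → Matrix (Fin d) (Fin T) ℝ}

/-- Otherwise the whitened row would vanish, against isotropy. All nondegeneracy of the second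
moment matrix is drawn from this. -/
lemma invSqrt_noiseSigma_ne_zero (h : SubGaussianNoise μ ε) (hT : 0 < T) :
    invSqrt (noiseSigma μ ε) ≠ 0 := by
  intro h0
  have := congrFun (congrFun h.isotropic ⟨0, hT⟩) ⟨0, hT⟩
  have hw : ∀ ω, whiten μ (fun ω => ε ω 0) ω = 0 := fun ω => by
    have : ε ω 0 ᵥ* invSqrt (noiseSigma μ ε) = 0 := by rw [h0, Matrix.vecMul_zero]
    exact this
  simp [secondMoment, hw] at this

lemma opNorm_noiseSigma_pos (h : SubGaussianNoise μ ε) (hT : 0 < T) :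
    0 < opNorm (noiseSigma μ ε) :=
  opNorm_pos_of_ne_zero fun h0 => h.invSqrt_noiseSigma_ne_zero hT (by rw [h0, invSqrt_zero])

lemma noiseNorm_toReal_pos (h : SubGaussianNoise μ ε) (hT : 0 < T) :
    0 < (noiseNorm μ ε).toReal := by
  refine ENNReal.toReal_pos (fun h0 => ?_) h.norm_lt_top.ne
  set x : EuclideanSpace ℝ (Fin T) := EuclideanSpace.single ⟨0, hT⟩ 1
  have h1 := eLpNorm_le_of_subGaussianNorm (μ := μ) (whiten μ fun ω => ε ω 0) (K := 0)
    (by rw [ENNReal.ofReal_zero]; exact h0.le) x (p := 2) (by norm_num)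
  simp only [mul_zero, zero_mul, ENNReal.ofReal_zero, nonpos_iff_eq_zero] at h1
  have hm : Measurable (fun ω => ε ω 0) := h.measurable_row 0
  have hmw : Measurable (fun ω => ∑ t, whiten μ (fun ω => ε ω 0) ω t * x t) := by
    refine Finset.measurable_sum _ fun t _ => Measurable.mul_const ?_ _
    unfold whiten Matrix.vecMul dotProduct
    exact Finset.measurable_sum _ fun j _ => ((measurable_pi_apply j).comp hm).mul_const _
  rw [eLpNorm_eq_zero_iff hmw.aestronglyMeasurable (by simp)] at h1
  have h2 := congrFun (congrFun h.isotropic ⟨0, hT⟩) ⟨0, hT⟩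
  have h3 : ∫ ω, whiten μ (fun ω => ε ω 0) ω ⟨0, hT⟩ * whiten μ (fun ω => ε ω 0) ω ⟨0, hT⟩ ∂μ
      = 0 := by
    refine integral_eq_zero_of_ae ?_
    filter_upwards [h1] with ω hω
    simp [x] at hω
    simp [hω]
  simp only [secondMoment, Matrix.of_apply, Matrix.one_apply_eq] at h2
  rw [h3] at h2
  exact zero_ne_one h2

/-- The moment bounds for the linear forms in the rows of the noise. -/
lemma eLpNorm_row_le (h : SubGaussianNoise μ ε) (hT : 0 < T)
    (x : EuclideanSpace ℝ (Fin T)) (i : Fin d) (p : ℝ) (hp : 1 ≤ p) :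
    eLpNorm (fun ω => ∑ t, ε ω i t * x t) (ENNReal.ofReal p) μ ≤
      ENNReal.ofReal √(p * ((noiseNorm μ ε).toReal ^ 2 * opNorm (noiseSigma μ ε) * ‖x‖ ^ 2)) := by
  have hid : eLpNorm (fun ω => ∑ t, ε ω i t * x t) (ENNReal.ofReal p) μ =
      eLpNorm (fun ω => ∑ t, ε ω 0 t * x t) (ENNReal.ofReal p) μ := by
    have hlin : Measurable (fun r : Fin T → ℝ => ∑ t, r t * x t) :=
      Finset.measurable_sum _ fun t _ => (measurable_pi_apply t).mul_const _
    exact ((h.ident i 0).comp hlin).eLpNorm_eq _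
  obtain ⟨R, hR, hRx⟩ := exists_sqrt_of_invSqrt_ne_zero (h.invSqrt_noiseSigma_ne_zero hT)
  -- With `R` the square root of the second moment matrix, `⟨ε, x⟩` is the whitened row paired with
  -- `R x`.
  set y : EuclideanSpace ℝ (Fin T) := WithLp.toLp 2 (R *ᵥ x)
  have hw : (fun ω => ∑ t, ε ω 0 t * x t) =
      fun ω => ∑ t, whiten μ (fun ω => ε ω 0) ω t * y t := by
    ext ω
    have : (ε ω 0 ᵥ* invSqrt (noiseSigma μ ε)) ⬝ᵥ (R *ᵥ x) = ε ω 0 ⬝ᵥ x := by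
      rw [Matrix.dotProduct_mulVec, Matrix.vecMul_vecMul, hR, Matrix.vecMul_one]
    exact this.symm
  rw [hid, hw]
  refine (eLpNorm_le_of_subGaussianNorm (μ := μ) _
    (ENNReal.ofReal_toReal h.norm_lt_top.ne).ge y hp).trans ?_
  refine ENNReal.ofReal_le_ofReal (Real.le_sqrt_of_sq_le ?_)
  have hp0 : 0 ≤ p := by linarith
  rw [mul_pow, mul_pow, Real.sq_sqrt hp0, mul_assoc, mul_assoc]
  gcongr
  exact hRx x

end SubGaussianNoise

end Whitening

end TimeSeriesFactorization

namespace TimeSeriesFactorization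

/-! ### Union bound over pairs of dimensions, and the final arithmetic. -/

section Oracle

variable {Ω : Type*} [MeasurableSpace Ω] {μ : Measure Ω}

lemma sum_exp_neg_le_one {T : ℕ} {𝒯 : Finset ℕ} (h : 𝒯 ⊆ Finset.Icc 1 T) :
    ∑ τ ∈ 𝒯, Real.exp (-(τ : ℝ)) ≤ 1 := by
  have hgeom : ∀ n : ℕ, ∑ τ ∈ Finset.Icc 1 n, (1 / 2 : ℝ) ^ τ = 1 - (1 / 2) ^ n := by
    intro n
    induction n with
    | zero => simp
    | succ n ih =>
      rw [Finset.sum_Icc_succ_top (by omega), ih]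
      ring
  have hexp : Real.exp (-1) ≤ 1 / 2 := by
    rw [Real.exp_neg, one_div]
    have := Real.add_one_le_exp 1
    gcongr
    linarith
  calc _ ≤ ∑ τ ∈ Finset.Icc 1 T, Real.exp (-(τ : ℝ)) :=
        Finset.sum_le_sum_of_subset_of_nonneg h fun _ _ _ => (Real.exp_pos _).le
    _ ≤ ∑ τ ∈ Finset.Icc 1 T, (1 / 2 : ℝ) ^ τ := by
        refine Finset.sum_le_sum fun τ _ => ?_
        calc Real.exp (-(τ : ℝ)) = Real.exp (-1) ^ τ := by
              rw [← Real.exp_nat_mul]; congr 1; ring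
          _ ≤ _ := by gcongr
    _ ≤ 1 := by
        rw [hgeom]
        have : (0 : ℝ) ≤ (1 / 2) ^ T := by positivity
        linarith

/-- The noise is simultaneously bounded on the sums of two of the spaces attached to `Λ`. -/
lemma SubGaussianNoise.exists_event_forall_boundedOn [IsProbabilityMeasure μ] {𝕜 : Type*}
    [RCLike 𝕜] {d T : ℕ} [NeZero d] {ε : Ω → Matrix (Fin d) (Fin T) ℝ}
    (h : SubGaussianNoise μ ε) (hT : 0 < T) {𝒯 : Finset ℕ} (h𝒯 : 𝒯 ⊆ Finset.Icc 1 T)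
    (Λ : (τ : ℕ) → Matrix (Fin τ) (Fin T) 𝕜) {s : ℝ} (hs : 0 ≤ s) :
    ∃ E : Set Ω, MeasurableSet E ∧ 1 - Real.exp (-s) ≤ μ.real E ∧
      ∀ ω ∈ E, ∀ τ ∈ 𝒯, ∀ τ' ∈ 𝒯, BoundedOn (ε ω) (reRowSpace (Λ τ) ⊔ reRowSpace (Λ τ'))
        (16 * Real.exp 1 * ((noiseNorm μ ε).toReal ^ 2 * opNorm (noiseSigma μ ε)) *
          (d + s + 5 * (τ + τ'))) := by
  have hG : 0 < (noiseNorm μ ε).toReal ^ 2 * opNorm (noiseSigma μ ε) :=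
    mul_pos (pow_pos (h.noiseNorm_toReal_pos hT) 2) (h.opNorm_noiseSigma_pos hT)
  have hD : ∀ q : ℕ × ℕ, Module.finrank ℝ
      (reRowSpace (Λ q.1) ⊔ reRowSpace (Λ q.2) : Submodule ℝ (EuclideanSpace ℝ (Fin T))) ≤
      2 * q.1 + 2 * q.2 := fun q =>
    (Submodule.finrank_add_le_finrank_add_finrank _ _).trans
      (add_le_add (finrank_reRowSpace_le _) (finrank_reRowSpace_le _))
  -- With `D = 2τ + 2τ'` and level `u = s + τ + τ'`, the quantity `d + 2D + u` equals `d + s + 5(τ +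
  -- τ')`. The exponential weights sum to at most `1` since dimensions start at `1`.
  choose E hEm hEμ hE using fun q : ℕ × ℕ => exists_event_boundedOn h.measurable_row h.indep hG
    (h.eLpNorm_row_le hT) (reRowSpace (Λ q.1) ⊔ reRowSpace (Λ q.2)) (hD q)
    (u := s + q.1 + q.2) (by positivity)
  have hsum : μ (⋃ q ∈ 𝒯 ×ˢ 𝒯, (E q)ᶜ) ≤ ENNReal.ofReal (Real.exp (-s)) := by
    calc _ ≤ ∑ q ∈ 𝒯 ×ˢ 𝒯, μ (E q)ᶜ := measure_biUnion_finset_le _ _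
      _ ≤ ∑ q ∈ 𝒯 ×ˢ 𝒯, ENNReal.ofReal (Real.exp (-(s + q.1 + q.2))) :=
          Finset.sum_le_sum fun q _ => hEμ q
      _ = ENNReal.ofReal (Real.exp (-s) * ((∑ τ ∈ 𝒯, Real.exp (-(τ : ℝ))) *
            ∑ τ ∈ 𝒯, Real.exp (-(τ : ℝ)))) := by
          rw [← ENNReal.ofReal_sum_of_nonneg fun _ _ => (Real.exp_pos _).le,
            Finset.sum_mul_sum, ← Finset.sum_product', Finset.mul_sum]
          congr 1
          refine Finset.sum_congr rfl fun q _ => ?_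
          rw [← Real.exp_add, ← Real.exp_add]
          congr 1
          ring
      _ ≤ ENNReal.ofReal (Real.exp (-s) * 1) := by
          gcongr
          exact mul_le_one₀ (sum_exp_neg_le_one h𝒯)
            (Finset.sum_nonneg fun _ _ => (Real.exp_pos _).le) (sum_exp_neg_le_one h𝒯)
      _ = _ := by rw [mul_one]
  have hUm : MeasurableSet (⋃ q ∈ 𝒯 ×ˢ 𝒯, (E q)ᶜ) :=
    Finset.measurableSet_biUnion _ fun q _ => (hEm q).compl
  refine ⟨(⋃ q ∈ 𝒯 ×ˢ 𝒯, (E q)ᶜ)ᶜ, hUm.compl, ?_, fun ω hω τ hτ τ' hτ' => ?_⟩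
  · rw [probReal_compl_eq_one_sub hUm]
    have : μ.real (⋃ q ∈ 𝒯 ×ˢ 𝒯, (E q)ᶜ) ≤ Real.exp (-s) :=
      ENNReal.toReal_le_of_le_ofReal (Real.exp_pos _).le hsum
    linarith
  · simp only [Set.mem_compl_iff, Set.mem_iUnion, not_exists, not_not] at hω
    have := hE (τ, τ') ω (hω (τ, τ') (Finset.mk_mem_product hτ hτ'))
    convert this using 2
    push_cast
    ring

lemma frobNorm_sub_comm {𝕜 : Type*} [RCLike 𝕜] {m n : ℕ} (A B : Matrix (Fin m) (Fin n) 𝕜) :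
    frobNorm (A - B) = frobNorm (B - A) :=
  let := @Matrix.frobeniusNormedAddCommGroup (Fin m) (Fin n) 𝕜 _ _ _
  norm_sub_rev A B

/-- The only cross term is `20kτ' ≤ 20k'τ'`; with the `40k'τ'` already present it gives the constant
`60`. -/
lemma rank_weighted_le {c d s τ τ' k k' : ℝ} (hc : 0 ≤ c) (hd : 0 ≤ d) (hs : 0 ≤ s)
    (hτ : 0 ≤ τ) (hτ' : 0 ≤ τ') (hk : 0 ≤ k) (hk' : 0 ≤ k') (hkk' : k ≤ k') :
    4 * (k * (c * (d + s + 5 * (τ + τ'))) + k' * (c * (d + s + 5 * (τ' + τ')))) ≤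
      60 * c * (k * (d + τ + s) + k' * (d + τ' + s)) := by
  have h1 : k * τ' ≤ k' * τ' := by gcongr
  have h2 : 4 * (k * (d + s + 5 * (τ + τ')) + k' * (d + s + 5 * (τ' + τ'))) ≤
      60 * (k * (d + τ + s) + k' * (d + τ' + s)) := by
    nlinarith [mul_nonneg hk hd, mul_nonneg hk hs, mul_nonneg hk hτ, mul_nonneg hk' hd,
      mul_nonneg hk' hs, mul_nonneg hk' hτ']
  calc _ = c * (4 * (k * (d + s + 5 * (τ + τ')) + k' * (d + s + 5 * (τ' + τ')))) := by ring
    _ ≤ c * (60 * (k * (d + τ + s) + k' * (d + τ' + s))) := by gcongr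
    _ = _ := by ring

/-- The bound is symmetric in the two matrices, so the projection may be taken on the side with the
smaller rank bound. -/
lemma reInner_sub_sq_le {𝕜 : Type*} [RCLike 𝕜] {d T : ℕ} {E : Matrix (Fin d) (Fin T) ℝ}
    {𝒯 : Finset ℕ} {Λ : (τ : ℕ) → Matrix (Fin τ) (Fin T) 𝕜} {c s : ℝ} (hc : 0 ≤ c) (hs : 0 ≤ s)
    (hE : ∀ τ ∈ 𝒯, ∀ τ' ∈ 𝒯, BoundedOn E (reRowSpace (Λ τ) ⊔ reRowSpace (Λ τ'))
      (c * (d + s + 5 * (τ + τ'))))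
    {τ τ' k k' : ℕ} (hτ : τ ∈ 𝒯) (hτ' : τ' ∈ 𝒯) {A : Matrix (Fin d) (Fin τ) 𝕜}
    {A' : Matrix (Fin d) (Fin τ') 𝕜} (hA : A.rank ≤ k) (hA' : A'.rank ≤ k') :
    reInner E (A * Λ τ - A' * Λ τ') ^ 2 ≤
      60 * c * (k * (d + τ + s) + k' * (d + τ' + s)) *
        frobNorm (A * Λ τ - A' * Λ τ') ^ 2 := by
  wlog hkk' : k ≤ k' generalizing τ τ' k k'
  · have h1 := this hτ' hτ hA' hA (le_of_not_ge hkk')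
    rw [frobNorm_sub_comm, add_comm (k * _ : ℝ)]
    rwa [show reInner E (A * Λ τ - A' * Λ τ') ^ 2 = reInner E (A' * Λ τ' - A * Λ τ) ^ 2 by
      rw [reInner_sub, reInner_sub]; ring]
  have hself := hE τ' hτ' τ' hτ'
  rw [sup_idem] at hself
  refine (reInner_sq_le_of_boundedOn E A A' (Λ τ) (Λ τ') k k' hA hA' _ _ (by positivity)
    (by positivity) (hE τ hτ τ' hτ') hself).trans ?_
  gcongr ?_ * _
  exact rank_weighted_le hc (by positivity) hs (by positivity) (by positivity) (by positivity)
    (by positivity) (by exact_mod_cast hkk')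

/-- The penalty at `(τ', k')` dominates its noise term. At `(τ, k)`, `k ≤ d` bounds the penalty by
twice its main part, so noise and penalty contribute `2 + 4 = 6 ≤ 16`. -/
lemma oracle_arith {𝔠 lam v s a b d τ τ' k k' : ℝ} (h𝔠 : 0 ≤ 𝔠) (h0 : 0 < lam) (h1 : lam < 1)
    (hv : 0 ≤ v) (hs : 0 ≤ s) (hd : 0 ≤ d) (hτ : 0 ≤ τ) (hτ' : 0 ≤ τ') (hk : 0 ≤ k)
    (hk' : 0 ≤ k') (hkd : k ≤ d)
    (h : (1 - lam) * a ≤ (1 + lam) * b +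
      2 * (𝔠 * v * (k' * (d + τ' + s) + k * (d + τ + s))) / lam +
        2 * 𝔠 * k / lam * (d + τ + (s + τ + k)) * v -
        2 * 𝔠 * k' / lam * (d + τ' + (s + τ' + k')) * v) (hb : 0 ≤ b) :
    a ≤ ((1 + lam) / (1 - lam)) ^ 2 * b +
      16 * (𝔠 * v) / (lam * (1 - lam) ^ 2) * (k * (d + τ + s)) := by
  have hl : 0 < 1 - lam := by linarith
  set w := 𝔠 * v / lam
  have hw : 0 ≤ w := by positivity
  have e1 : 2 * (𝔠 * v * (k' * (d + τ' + s) + k * (d + τ + s))) / lam =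
      2 * (w * (k' * (d + τ' + s) + k * (d + τ + s))) := by simp only [w]; ring
  have e2 : ∀ x y : ℝ, 2 * 𝔠 * x / lam * y * v = 2 * (w * (x * y)) := fun x y => by
    simp only [w]; ring
  have e3 : 16 * (𝔠 * v) / (lam * (1 - lam) ^ 2) * (k * (d + τ + s)) =
      16 * (w * (k * (d + τ + s))) / (1 - lam) ^ 2 := by
    simp only [w]; field_simp
  rw [e1, e2, e2] at h
  have i1 : w * (k' * (d + τ' + s)) ≤ w * (k' * (d + τ' + (s + τ' + k'))) := by
    gcongr; linarith
  have i2 : w * (k * (d + τ + (s + τ + k))) ≤ w * (k * (2 * (d + τ + s))) := by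
    gcongr; linarith
  have h' : (1 - lam) * a ≤ (1 + lam) * b + 6 * (w * (k * (d + τ + s))) := by linarith
  have hY : 0 ≤ w * (k * (d + τ + s)) := by positivity
  rw [e3, div_pow, div_mul_eq_mul_div, ← add_div, le_div_iff₀ (by positivity)]
  calc a * (1 - lam) ^ 2 = (1 - lam) * ((1 - lam) * a) := by ring
    _ ≤ (1 - lam) * ((1 + lam) * b + 6 * (w * (k * (d + τ + s)))) := by gcongr
    _ ≤ _ := by
      nlinarith [mul_nonneg h0.le hY, mul_nonneg h0.le hb, mul_nonneg (mul_nonneg h0.le h0.le) hb]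

end Oracle

end TimeSeriesFactorization

theorem theorem4p1 :
    ∃ 𝔠 : ℝ, 1 < 𝔠 ∧
      ∀ (𝕜 : Type*) [RCLike 𝕜]
        (Ω : Type*) [MeasurableSpace Ω] (μ : Measure Ω) [IsProbabilityMeasure μ]
        (d T : ℕ) [NeZero d], 2 ≤ T →
      ∀ (M : Matrix (Fin d) (Fin T) ℝ) (ε : Ω → Matrix (Fin d) (Fin T) ℝ),
        TimeSeriesFactorization.SubGaussianNoise μ ε →
      ∀ 𝒯 𝒦 : Finset ℕ, 𝒯 ⊆ Finset.Icc 1 T → 𝒦 ⊆ Finset.Icc 1 (min d T) →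
      ∀ Λ : (τ : ℕ) → Matrix (Fin τ) (Fin T) 𝕜,
        (∀ τ ∈ 𝒯, ∃ c : ℝ, 0 < c ∧
          Λ τ * (Λ τ)ᴴ = (c : 𝕜) • (1 : Matrix (Fin τ) (Fin τ) 𝕜)) →
      ∀ S : (τ k : ℕ) → Set (Matrix (Fin d) (Fin τ) 𝕜),
        (∀ τ ∈ 𝒯, ∀ k ∈ 𝒦, ∀ A ∈ S τ k, A.rank ≤ k) →
      ∀ lam : ℝ, 0 < lam → lam < 1 → ∀ s : ℝ, 0 ≤ s →
      ∀ Mtilde : Ω → (τ k : ℕ) → Matrix (Fin d) (Fin τ) 𝕜,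
        (∀ ω, ∀ τ ∈ 𝒯, ∀ k ∈ 𝒦,
          TimeSeriesFactorization.IsERM (Λ τ) (S τ k) (M + ε ω) (Mtilde ω τ k)) →
      ∀ m : Ω → ℕ × ℕ,
        (∀ ω, TimeSeriesFactorization.IsPenalizedSelection 𝔠 lam
          (TimeSeriesFactorization.noiseKTilde μ ε *
            TimeSeriesFactorization.opNorm (TimeSeriesFactorization.noiseSigma μ ε))
          s 𝒯 𝒦 Λ (M + ε ω) (Mtilde ω) (m ω)) →
      ∃ E : Set Ω, MeasurableSet E ∧ 1 - 2 * Real.exp (-s) ≤ μ.real E ∧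
        ∀ ω ∈ E, ∀ τ ∈ 𝒯, ∀ k ∈ 𝒦, ∀ A ∈ S τ k,
          1 / ((d : ℝ) * T) *
              TimeSeriesFactorization.frobNorm
                (Mtilde ω (m ω).1 (m ω).2 * Λ (m ω).1 -
                  TimeSeriesFactorization.ofRealMatrix 𝕜 M) ^ 2 ≤
            ((1 + lam) / (1 - lam)) ^ 2 *
                (1 / ((d : ℝ) * T) *
                  TimeSeriesFactorization.frobNorm
                    (A * Λ τ - TimeSeriesFactorization.ofRealMatrix 𝕜 M) ^ 2) +
              16 * 𝔠 * TimeSeriesFactorization.noiseKTilde μ ε *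
                  TimeSeriesFactorization.opNorm (TimeSeriesFactorization.noiseSigma μ ε) /
                  (lam * (1 - lam) ^ 2) *
                ((k : ℝ) * (d + τ + s) / ((d : ℝ) * T)) := by
  open TimeSeriesFactorization in
  -- It must exceed `60 * 16 * e`, about `2610`.
  refine ⟨3000, by norm_num, ?_⟩
  intro 𝕜 _ Ω _ μ _ d T _ hT M ε hε 𝒯 𝒦 h𝒯 h𝒦 Λ hΛ S hS lam h0 h1 s hs Mt hMt m hm
  obtain ⟨E, hEm, hEμ, hE⟩ := hε.exists_event_forall_boundedOn (by omega) h𝒯 Λ hs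
  refine ⟨E, hEm, by linarith [Real.exp_pos (-s)], fun ω hω τ hτ k hk A hA => ?_⟩
  obtain ⟨hmem, hmin⟩ := hm ω
  obtain ⟨hτ', hk'⟩ := Finset.mem_product.1 hmem
  set τ' := (m ω).1
  set k' := (m ω).2
  have hMS := hMt ω τ' hτ' k' hk'
  set O := opNorm (noiseSigma μ ε)
  set K := (noiseNorm μ ε).toReal
  set v := noiseKTilde μ ε * O
  have hO : 0 ≤ O := opNorm_nonneg _
  have hKv : K ^ 2 * O ≤ v := mul_le_mul_of_nonneg_right (le_max_left _ _) hO
  have hv : 0 ≤ v := le_trans (by positivity) hKv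
  -- The selection compares with the minimizer for `(τ, k)`, whose fit to the data is at least as
  -- good as that of `A`.
  have hsel : frobNorm (Mt ω τ' k' * Λ τ' - ofRealMatrix 𝕜 (M + ε ω)) ^ 2 +
      penalty 3000 lam v d (s + τ' + k') τ' k' ≤
      frobNorm (A * Λ τ - ofRealMatrix 𝕜 (M + ε ω)) ^ 2 +
        penalty 3000 lam v d (s + τ + k) τ k := by
    have h2 := (isMinOn_iff.1 hmin) (τ, k) (Finset.mem_coe.2 (Finset.mk_mem_product hτ hk))
    have h3 := (hMt ω τ hτ k hk).frobNorm_mul_sub_le (hΛ τ hτ) hA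
    exact h2.trans (by gcongr)
  have hN := reInner_sub_sq_le (by positivity) hs (hE ω hω) hτ' hτ
    (hS τ' hτ' k' hk' _ hMS.1) (hS τ hτ k hk A hA)
  have hN' := hN.trans (b := _) (c := 3000 * v * (k' * (d + τ' + s) + k * (d + τ + s)) *
      frobNorm (Mt ω τ' k' * Λ τ' - A * Λ τ) ^ 2) (by
    gcongr ?_ * _ * _
    have he := Real.exp_one_lt_d9
    have hKO : 0 ≤ K ^ 2 * O := by positivity
    nlinarith)
  have hor := oracle_of_noise_bound M (ε ω) _ _ lam _ _ _ h0 hsel hN' (by positivity)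
  have hkd : (k : ℝ) ≤ d := by
    exact_mod_cast (Finset.mem_Icc.1 (h𝒦 hk)).2.trans (min_le_left _ _)
  have hfin := oracle_arith (by norm_num) h0 h1 hv hs (Nat.cast_nonneg d) (Nat.cast_nonneg τ)
    (Nat.cast_nonneg τ') (Nat.cast_nonneg k) (Nat.cast_nonneg k') hkd hor (sq_nonneg _)
  calc _ ≤ 1 / ((d : ℝ) * T) * (((1 + lam) / (1 - lam)) ^ 2 *
        frobNorm (A * Λ τ - ofRealMatrix 𝕜 M) ^ 2 +
        16 * (3000 * v) / (lam * (1 - lam) ^ 2) * (k * (d + τ + s))) := by gcongr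
    _ = _ := by simp only [v]; ring
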